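/- An instance of vertex-weighted online bipartite matching with stochastic rewards consists of a finite bipartite graph $G=(I,T,E)$ with resources $I$ and arrivals $T=\{1,\dots,m\}$, vertex weights $r_i\ge 0$ for $i\in I$, and success probabilities $p_{it}\in[0,1]$ for $(i,t)\in E$. If an arrival $t$ is matched to an available neighbor $i$, the match succeeds with probability $p_{it}$, independently of all other events. On success the reward $r_i$ is collected and $i$ becomes unavailable; on failure nothing is collected and $i$ stays available. In either case $t$ cannot be matched again. The Perturbed Greedy algorithm draws independent seeds $y_i$, uniform on $[0,1]$, for $i\in I$, independently of the outcomes of the matches, and processes the arrivals in the order $1,\dots,m$. It matches each arrival $t$ that has an available neighbor to an available neighbor $i$ that maximizes $p_{it}r_i(1-e^{y_i-1})$, with ties broken by any fixed deterministic rule that depends only on $t$ and the set of maximizers. Let $\mathrm{ALG}(\nu)$ be its expected total reward on the instance $\nu$. A non-anticipative offline algorithm knows the whole instance (graph, weights and probabilities), may match arrivals in any order, may be adaptive and randomized, and observes the success or failure of an edge immediately after including that edge in the matching, but not before. Let $\mathrm{OPT}(\nu)$ be the supremum of the expected total rewards of such algorithms on $\nu$. **Theorem.** Let $\nu$ be an instance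 with decomposable probabilities: there are $p_i\in[0,1]$ for $i\in I$ and $p_t\in[0,1]$ for $t\in T$ such that $p_{it}=p_ip_t$ for all $(i,t)\in E$. Then Perturbed Greedy is $(1-1/e)$-competitive on $\nu$: $$\mathrm{ALG}(\nu)\ \ge\ \Bigl(1-\frac1e\Bigr)\,\mathrm{OPT}(\nu).$$ -/

import Mathlib

set_option linter.unusedSectionVars false

open MeasureTheory

/-- An instance of vertex-weighted online bipartite matching with stochastic rewards.
`I` is the set of resources; the arrivals are `Fin m`, in the order of their index.
`prob i t` is meaningful only when `(i, t)` is an edge (its value at a non-edge is never used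
by an algorithm). -/
structure StochasticMatching (I : Type*) (m : ℕ) where
  edges : Finset (I × Fin m)
  weight : I → ℝ
  weight_nonneg : ∀ i, 0 ≤ weight i
  prob : I → Fin m → ℝ
  prob_nonneg : ∀ i t, 0 ≤ prob i t
  prob_le_one : ∀ i t, prob i t ≤ 1

/-- A deterministic offline plan, as a decision tree. It may consider the arrivals in any order.
`probe i t a b` includes the edge `(i, t)` in the matching, observes whether the match
succeeds, and continues with `a` after a success and with `b` after a failure. As the tree branches
only on the outcomes of edges already included, the plan is non-anticipative. -/
inductive OfflinePlan (I : Type*) (m : ℕ) where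
  | finish : OfflinePlan I m
  | probe (i : I) (t : Fin m) (onSuccess onFailure : OfflinePlan I m) : OfflinePlan I m

/-- A rule that selects one element of each nonempty set of tied resources (the rule may also
depend on the arrival). -/
structure TieBreaking (I : Type*) (m : ℕ) where
  pick : Fin m → (A : Finset I) → A.Nonempty → I
  pick_mem : ∀ t A hA, pick t A hA ∈ A

namespace StochasticMatching

variable {I : Type*} [Fintype I] [DecidableEq I] {m : ℕ}

/-- Every edge probability is the product of a probability of the resource and a probability of the
arrival. -/
def Decomposable (ν : StochasticMatching I m) : Prop :=
  ∃ (a : I → ℝ) (b : Fin m → ℝ),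
    (∀ i, 0 ≤ a i ∧ a i ≤ 1) ∧ (∀ t, 0 ≤ b t ∧ b t ≤ 1) ∧
      ∀ i t, (i, t) ∈ ν.edges → ν.prob i t = a i * b t

/-- The probability of the sample path `s`, where `s (i, t)` says whether a match of `t` to `i` would
succeed: the outcomes of the pairs are independent, with success probability `prob i t`. -/
noncomputable def pathProb (ν : StochasticMatching I m) (s : I × Fin m → Bool) : ℝ :=
  ∏ e : I × Fin m, if s e then ν.prob e.1 e.2 else 1 - ν.prob e.1 e.2

/-! ### The Perturbed Greedy algorithm -/

/-- The perturbed expected reward of resource `i` at arrival `t`. -/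
noncomputable def perturbedReward (ν : StochasticMatching I m) (y : I → unitInterval)
    (t : Fin m) (i : I) : ℝ :=
  ν.prob i t * ν.weight i * (1 - Real.exp ((y i : ℝ) - 1))

/-- The available neighbors of `t`, when `S` is the set of available resources. -/
def candidates (ν : StochasticMatching I m) (S : Finset I) (t : Fin m) : Finset I :=
  S.filter fun i => (i, t) ∈ ν.edges

/-- The available neighbors of `t` with the highest perturbed expected reward. -/
noncomputable def greedyArgmax (ν : StochasticMatching I m) (y : I → unitInterval)
    (S : Finset I) (t : Fin m) : Finset I :=
  (ν.candidates S t).filter fun i =>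
    ∀ j ∈ ν.candidates S t, ν.perturbedReward y t j ≤ ν.perturbedReward y t i

/-- The resource that Perturbed Greedy offers to `t` (`none` if `t` has no available neighbor). -/
noncomputable def greedyOffer (ν : StochasticMatching I m) (tie : TieBreaking I m)
    (y : I → unitInterval) (S : Finset I) (t : Fin m) : Option I :=
  if h : (ν.greedyArgmax y S t).Nonempty then some (tie.pick t _ h) else none

/-- The total reward that Perturbed Greedy collects on the sample path `s` from the arrivals in a
list, processed in this order, when it starts from the set `S` of available resources. -/
noncomputable def greedyReward (ν : StochasticMatching I m) (tie : TieBreaking I m)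
    (y : I → unitInterval) (s : I × Fin m → Bool) : List (Fin m) → Finset I → ℝ
  | [], _ => 0
  | t :: ts, S =>
    match ν.greedyOffer tie y S t with
    | none => ν.greedyReward tie y s ts S
    | some i =>
      if s (i, t) then ν.weight i + ν.greedyReward tie y s ts (S.erase i)
      else ν.greedyReward tie y s ts S

/-- The expected total reward of Perturbed Greedy. The seeds `y i` are independent and uniform on
`[0, 1]` (`volume` on `I → unitInterval` is the product of the uniform distributions), and they are
independent of the sample path. -/
noncomputable def perturbedGreedy (ν : StochasticMatching I m) (tie : TieBreaking I m) : ℝ :=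
  ∫ y : I → unitInterval,
    ∑ s : I × Fin m → Bool,
      ν.pathProb s * ν.greedyReward tie y s (List.finRange m) Finset.univ

/-! ### The non-anticipative offline benchmark -/

/-- The plan includes only edges between an available resource and an unmatched arrival, when it
starts from available resources `S` and unmatched arrivals `T`. A resource is unavailable after a
successful match; an arrival is used up by every match, successful or not. -/
def Feasible (ν : StochasticMatching I m) : OfflinePlan I m → Finset I → Finset (Fin m) → Prop
  | .finish, _, _ => True
  | .probe i t a b, S, T =>
    i ∈ S ∧ t ∈ T ∧ (i, t) ∈ ν.edges ∧
      ν.Feasible a (S.erase i) (T.erase t) ∧ ν.Feasible b S (T.erase t)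

/-- The total reward of a plan on the sample path `s`. -/
noncomputable def planReward (ν : StochasticMatching I m) (s : I × Fin m → Bool) :
    OfflinePlan I m → ℝ
  | .finish => 0
  | .probe i t a b => if s (i, t) then ν.weight i + ν.planReward s a else ν.planReward s b

/-- The expected total reward of a plan. -/
noncomputable def planValue (ν : StochasticMatching I m) (π : OfflinePlan I m) : ℝ :=
  ∑ s : I × Fin m → Bool, ν.pathProb s * ν.planReward s π

/-- A (possibly randomized) non-anticipative offline algorithm for the instance `ν`, which it knows:
it draws a feasible plan at random, independently of the sample path. -/
abbrev OfflineAlgorithm (ν : StochasticMatching I m) : Type _ :=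
  PMF {π : OfflinePlan I m // ν.Feasible π Finset.univ Finset.univ}

/-- The expected total reward of an offline algorithm. -/
noncomputable def offlineValue (ν : StochasticMatching I m) (q : ν.OfflineAlgorithm) : ℝ :=
  ∑' π, (q π).toReal * ν.planValue π.1

/-- The optimal expected total reward of a non-anticipative offline algorithm. -/
noncomputable def opt (ν : StochasticMatching I m) : ℝ :=
  ⨆ q : ν.OfflineAlgorithm, ν.offlineValue q

/-! ### The benchmark is well defined -/

theorem pathProb_nonneg (ν : StochasticMatching I m) (s : I × Fin m → Bool) :
    0 ≤ ν.pathProb s := by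
  refine Finset.prod_nonneg fun e _ => ?_
  split_ifs
  · exact ν.prob_nonneg _ _
  · linarith [ν.prob_le_one e.1 e.2]

theorem sum_pathProb (ν : StochasticMatching I m) : ∑ s, ν.pathProb s = 1 := by
  have h := (Finset.prod_univ_sum (fun _ : I × Fin m => (Finset.univ : Finset Bool))
    (fun e b => if b then ν.prob e.1 e.2 else 1 - ν.prob e.1 e.2))
  rw [Fintype.piFinset_univ] at h
  unfold pathProb
  rw [← h]
  simp

theorem planReward_nonneg (ν : StochasticMatching I m) (s : I × Fin m → Bool)
    (π : OfflinePlan I m) : 0 ≤ ν.planReward s π := by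
  induction π with
  | finish => simp [planReward]
  | probe i t a b ha hb =>
    unfold planReward
    split_ifs
    · linarith [ν.weight_nonneg i]
    · exact hb

theorem planReward_le (ν : StochasticMatching I m) (s : I × Fin m → Bool)
    (π : OfflinePlan I m) (S : Finset I) (T : Finset (Fin m)) (h : ν.Feasible π S T) :
    ν.planReward s π ≤ ∑ i ∈ S, ν.weight i := by
  induction π generalizing S T with
  | finish => simpa [planReward] using Finset.sum_nonneg fun i _ => ν.weight_nonneg i
  | probe i t a b ha hb =>
    obtain ⟨hi, -, -, h1, h2⟩ := h
    unfold planReward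
    split_ifs
    · rw [← Finset.add_sum_erase S _ hi]
      linarith [ha _ _ h1]
    · exact hb _ _ h2

theorem planValue_nonneg (ν : StochasticMatching I m) (π : OfflinePlan I m) :
    0 ≤ ν.planValue π :=
  Finset.sum_nonneg fun s _ => mul_nonneg (ν.pathProb_nonneg s) (ν.planReward_nonneg s π)

theorem planValue_le (ν : StochasticMatching I m) (π : OfflinePlan I m)
    (h : ν.Feasible π Finset.univ Finset.univ) : ν.planValue π ≤ ∑ i, ν.weight i := by
  calc ν.planValue π ≤ ∑ s, ν.pathProb s * ∑ i, ν.weight i :=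
        Finset.sum_le_sum fun s _ =>
          mul_le_mul_of_nonneg_left (ν.planReward_le s π _ _ h) (ν.pathProb_nonneg s)
    _ = ∑ i, ν.weight i := by rw [← Finset.sum_mul, sum_pathProb, one_mul]

theorem hasSum_toReal (ν : StochasticMatching I m) (q : ν.OfflineAlgorithm) :
    HasSum (fun π => (q π).toReal) 1 := by
  have h := ENNReal.hasSum_toReal (f := fun π => q π) (by simp [q.tsum_coe])
  rwa [← ENNReal.tsum_toReal_eq (fun π => q.apply_ne_top π), q.tsum_coe,
    ENNReal.toReal_one] at h

/-- The sum that defines the expected reward of an offline algorithm converges. -/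
theorem summable_offlineValue (ν : StochasticMatching I m) (q : ν.OfflineAlgorithm) :
    Summable fun π => (q π).toReal * ν.planValue π.1 :=
  Summable.of_nonneg_of_le
    (fun π => mul_nonneg ENNReal.toReal_nonneg (ν.planValue_nonneg π.1))
    (fun π => mul_le_mul_of_nonneg_left (ν.planValue_le π.1 π.2) ENNReal.toReal_nonneg)
    ((ν.hasSum_toReal q).summable.mul_right _)

theorem offlineValue_le (ν : StochasticMatching I m) (q : ν.OfflineAlgorithm) :
    ν.offlineValue q ≤ ∑ i, ν.weight i := by
  have h1 := (ν.hasSum_toReal q).mul_right (∑ i, ν.weight i)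
  rw [one_mul] at h1
  have h2 : ∀ π, (q π).toReal * ν.planValue π.1 ≤ (q π).toReal * ∑ i, ν.weight i := fun π =>
    mul_le_mul_of_nonneg_left (ν.planValue_le π.1 π.2) ENNReal.toReal_nonneg
  exact hasSum_le h2 (ν.summable_offlineValue q).hasSum h1

/-- The supremum that defines `opt` is over a bounded set. -/
theorem bddAbove_offlineValue (ν : StochasticMatching I m) :
    BddAbove (Set.range fun q : ν.OfflineAlgorithm => ν.offlineValue q) :=
  ⟨∑ i, ν.weight i, Set.forall_mem_range.2 ν.offlineValue_le⟩

/-- The supremum that defines `opt` is over a nonempty set. -/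
theorem nonempty_offlineAlgorithm (ν : StochasticMatching I m) : Nonempty ν.OfflineAlgorithm :=
  ⟨PMF.pure ⟨.finish, trivial⟩⟩

end StochasticMatching

/-!
The proof removes the randomness of the matches by presampling and then applies the dual fitting
argument for Perturbed Greedy with capacities.

Write `p_{it} = a_i b_t` and `w_i = a_i r_i`. Toss one coin with probability `b_t` for each arrival,
which says whether it is live, and for each resource `i` a sequence of coins with probability `a_i`,
which are used up in turn by the attempts at `i` from live arrivals. As no arrival is used
twice and no coin is looked at twice, every feasible plan has the same expected reward in
this model as in the original one, where an attempt at a live arrival is worth `w_i` in expectation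
(`bernoulliExp_planAttempts`). For fixed coins, resource `i` admits a fixed number `c_i` of
attempts, up to and including its first success. Hence the attempts of any plan at live
arrivals are a matching with capacities `c_i` and weights `w_i` (`exists_matching_planAttempts`).
Perturbed Greedy with fixed seeds is itself a plan (`greedyPlan`), and its attempts are the
greedy matching with the same capacities and with the values `v_i = w_i (1 - exp (y_i - 1))`,
because the factor `b_t` is common to all neighbors of `t`. Since both algorithms are run on the
same coins, it suffices to compare, for fixed coins, the greedy matching with an arbitrary
matching `M` (`le_integral_sum_greedyMatch`).

Split the weight of every attempt of the greedy matching: the share `w_i exp (y_i - 1)` goes to the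
resource and the value `v_i` goes to the arrival. Fix `i` and all seeds but `y_i`, and let `l_t` be
the value that `t` receives when `i` is removed. Almost surely there are no ties between positive
values, and then the presence of `i` leaves every arrival with at least `l_t`, and `i` is used
at least `min (c_i, k)` times, where `k` is the number of its live neighbors with `l_t < v_i`
(`greedyMatch_compare`). The second part holds because resources of a higher value than `i`
are not affected by `i`. Therefore `i` and the at most `c_i` arrivals that `M` matches to it
receive at least `l_t + w_i exp (y_i - 1) 1[l_t < v_i]` per arrival, whose average over `y_i` is at
least `(1 - 1 / e) w_i` (`le_integral_seed_gain`). Summation over `i` proves the claim.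
-/

/-! ### Expectations over independent coin flips -/

/-- The expectation of `f s` when the coins `s e` are independent and `s e` is `true` with
probability `p e`. -/
noncomputable def bernoulliExp {κ : Type*} [Fintype κ] [DecidableEq κ] (p : κ → ℝ)
    (f : (κ → Bool) → ℝ) : ℝ :=
  ∑ s : κ → Bool, (∏ e, if s e then p e else 1 - p e) * f s

section bernoulliExp

variable {κ : Type*} [Fintype κ] [DecidableEq κ] (p : κ → ℝ)

theorem bernoulliExp_eq_sum_ne (e : κ) (f : (κ → Bool) → ℝ) :
    bernoulliExp p f = ∑ u : {j // j ≠ e} → Bool,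
      (∏ j : {j // j ≠ e}, if u j then p j else 1 - p j) *
        (p e * f ((Equiv.funSplitAt e Bool).symm (true, u)) +
          (1 - p e) * f ((Equiv.funSplitAt e Bool).symm (false, u))) := by
  unfold bernoulliExp
  rw [← (Equiv.funSplitAt e Bool).symm.sum_comp, Fintype.sum_prod_type, Fintype.sum_bool,
    ← Finset.sum_add_distrib]
  refine Finset.sum_congr rfl fun u _ => ?_
  rw [Fintype.prod_eq_mul_prod_subtype_ne _ e, Fintype.prod_eq_mul_prod_subtype_ne _ e]
  have h : ∀ (b : Bool) (j : {j // j ≠ e}),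
      (Equiv.funSplitAt e Bool).symm (b, u) j = u j := fun b j => by
    simp [Equiv.funSplitAt, Equiv.piSplitAt, j.2]
  have h' : ∀ b : Bool, (Equiv.funSplitAt e Bool).symm (b, u) e = b := fun b => by
    simp [Equiv.funSplitAt, Equiv.piSplitAt]
  simp only [h, h']
  simp
  ring

/-- Conditioning on the coin `e`, when neither branch looks at this coin again. -/
theorem bernoulliExp_ite (e : κ) (g h : (κ → Bool) → ℝ)
    (hg : ∀ s b, g (Function.update s e b) = g s) (hh : ∀ s b, h (Function.update s e b) = h s) :
    bernoulliExp p (fun s => if s e then g s else h s) =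
      p e * bernoulliExp p g + (1 - p e) * bernoulliExp p h := by
  simp only [bernoulliExp_eq_sum_ne p e, Finset.mul_sum, ← Finset.sum_add_distrib]
  refine Finset.sum_congr rfl fun u _ => ?_
  have h1 : (Equiv.funSplitAt e Bool).symm (true, u) =
      Function.update ((Equiv.funSplitAt e Bool).symm (false, u)) e true := by
    ext j
    by_cases hj : j = e
    · subst hj; simp [Equiv.funSplitAt, Equiv.piSplitAt]
    · simp [Equiv.funSplitAt, Equiv.piSplitAt, hj]
  have h' : ∀ b : Bool, (Equiv.funSplitAt e Bool).symm (b, u) e = b := fun b => by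
    simp [Equiv.funSplitAt, Equiv.piSplitAt]
  simp only [h']
  rw [h1, hg, hh]
  simp
  ring

theorem bernoulliExp_const_add (c : ℝ) (f : (κ → Bool) → ℝ) :
    bernoulliExp p (fun s => c + f s) = c + bernoulliExp p f := by
  have h := Finset.prod_univ_sum (fun _ : κ => (Finset.univ : Finset Bool))
    (fun e b => if b then p e else 1 - p e)
  rw [Fintype.piFinset_univ] at h
  unfold bernoulliExp
  simp only [mul_add, Finset.sum_add_distrib]
  rw [← Finset.sum_mul, ← h]
  simp

end bernoulliExp

namespace StochasticMatching

variable {I : Type*} [Fintype I] [DecidableEq I] {m : ℕ}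

/-! ### The expected reward of a plan, by recursion on the tree -/

/-- The expected reward of a plan, computed along its tree: every probe is an independent trial. -/
noncomputable def planMean (ν : StochasticMatching I m) : OfflinePlan I m → ℝ
  | .finish => 0
  | .probe i t a b =>
    ν.prob i t * (ν.weight i + ν.planMean a) + (1 - ν.prob i t) * ν.planMean b

theorem planReward_congr (ν : StochasticMatching I m) {s s' : I × Fin m → Bool}
    (π : OfflinePlan I m) (S : Finset I) (T : Finset (Fin m)) (h : ν.Feasible π S T)
    (hs : ∀ i, ∀ t ∈ T, s (i, t) = s' (i, t)) : ν.planReward s π = ν.planReward s' π := by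
  induction π generalizing S T with
  | finish => rfl
  | probe i t a b ha hb =>
    obtain ⟨-, ht, -, h1, h2⟩ := h
    unfold planReward
    rw [hs i t ht, ha _ _ h1 fun j u hu => hs j u (Finset.mem_of_mem_erase hu),
      hb _ _ h2 fun j u hu => hs j u (Finset.mem_of_mem_erase hu)]

theorem planValue_eq_planMean (ν : StochasticMatching I m) (π : OfflinePlan I m)
    (S : Finset I) (T : Finset (Fin m)) (h : ν.Feasible π S T) :
    ν.planValue π = ν.planMean π := by
  have key : ∀ π, ν.planValue π =
    bernoulliExp (fun e : I × Fin m => ν.prob e.1 e.2) (fun s => ν.planReward s π) := fun _ => rfl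
  induction π generalizing S T with
  | finish => simp [planValue, planReward, planMean]
  | probe i t a b ha hb =>
    obtain ⟨-, ht, -, h1, h2⟩ := h
    have hu : ∀ (s : I × Fin m → Bool) (c : Bool) (j : I), ∀ u ∈ T.erase t,
        Function.update s (i, t) c (j, u) = s (j, u) := fun s c j u hu =>
      Function.update_of_ne (fun he => Finset.ne_of_mem_erase hu (Prod.ext_iff.1 he).2) _ _
    rw [key]
    simp only [planReward]
    rw [bernoulliExp_ite _ (i, t) (fun s => ν.weight i + ν.planReward s a)
        (fun s => ν.planReward s b)
        (fun s c => by rw [ν.planReward_congr a _ _ h1 (hu s c)])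
        (fun s c => ν.planReward_congr b _ _ h2 (hu s c)),
      bernoulliExp_const_add, ← key, ← key, ha _ _ h1, hb _ _ h2, planMean]

/-! ### Presampled capacities -/

/-- The number of attempts at resource `i` up to and including the first success, when `k` of its
coins are left. The coins of `i` are used in the order of decreasing index, so that the next one
has index `k - 1`. Without any success among the coins the value is `k + 1`, more than the number of
attempts that are ever made. -/
def capacity (s : Fin m ⊕ I × Fin m → Bool) (i : I) : ℕ → ℕ
  | 0 => 1
  | k + 1 => if h : k < m then if s (.inr (i, ⟨k, h⟩)) then 1 else capacity s i k + 1 else 1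

theorem capacity_pos (s : Fin m ⊕ I × Fin m → Bool) (i : I) (k : ℕ) : 0 < capacity s i k := by
  cases k with
  | zero => simp [capacity]
  | succ k => unfold capacity; split_ifs <;> simp

theorem capacity_congr {s s' : Fin m ⊕ I × Fin m → Bool} (i : I) (k : ℕ)
    (hs : ∀ j (h : j < m), j < k → s (.inr (i, ⟨j, h⟩)) = s' (.inr (i, ⟨j, h⟩))) :
    capacity s i k = capacity s' i k := by
  induction k with
  | zero => rfl
  | succ k ih =>
    unfold capacity
    rw [ih fun j h hj => hs j h (by omega)]
    by_cases h : k < m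
    · simp [h, hs k h (by omega)]
    · simp [h]

/-- The remaining capacities when `S` is the set of available resources and `n i` coins of resource
`i` are left. -/
def capacities (s : Fin m ⊕ I × Fin m → Bool) (S : Finset I) (n : I → ℕ) (i : I) : ℕ :=
  if i ∈ S then capacity s i (n i) else 0

/-- The sum of `w i` over the attempts that a plan makes at live arrivals, when the attempts at
resource `i` fail until its capacity `r i` is used up by a success. Attempts at other arrivals
fail without using capacity. -/
noncomputable def planAttempts (w : I → ℝ) (live : Fin m → Bool) :
    OfflinePlan I m → (I → ℕ) → ℝ
  | .finish, _ => 0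
  | .probe i t a b, r =>
    if live t then
      w i + if r i = 1 then planAttempts w live a (Function.update r i 0)
        else planAttempts w live b (Function.update r i (r i - 1))
    else planAttempts w live b r

theorem planAttempts_congr (ν : StochasticMatching I m) (w : I → ℝ) {live live' : Fin m → Bool}
    (π : OfflinePlan I m) (S : Finset I) (T : Finset (Fin m)) (h : ν.Feasible π S T)
    (hl : ∀ t ∈ T, live t = live' t) (r : I → ℕ) :
    planAttempts w live π r = planAttempts w live' π r := by
  induction π generalizing S T r with
  | finish => rfl
  | probe i t a b ha hb =>
    obtain ⟨-, ht, -, h1, h2⟩ := h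
    unfold planAttempts
    rw [hl t ht, ha _ _ h1 fun u hu => hl u (Finset.mem_of_mem_erase hu),
      hb _ _ h2 fun u hu => hl u (Finset.mem_of_mem_erase hu),
      hb _ _ h2 fun u hu => hl u (Finset.mem_of_mem_erase hu)]

/-- The reward of a plan can be computed from presampled coins: one per arrival, with probability
`b t`, which says whether the arrival is live, and a sequence for each resource, with probability
`a i`, which is used up by the attempts at live arrivals. An attempt at a live arrival is worth
`a i * weight i` in expectation. -/
theorem bernoulliExp_planAttempts (ν : StochasticMatching I m) {a : I → ℝ} {b : Fin m → ℝ}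
    (hab : ∀ i t, (i, t) ∈ ν.edges → ν.prob i t = a i * b t) (π : OfflinePlan I m)
    (S : Finset I) (T : Finset (Fin m)) (n : I → ℕ) (h : ν.Feasible π S T)
    (hn : ∀ i, T.card ≤ n i ∧ n i ≤ m) :
    bernoulliExp (Sum.elim b fun e : I × Fin m => a e.1)
      (fun s => planAttempts (fun i => a i * ν.weight i) (fun t => s (.inl t)) π
        (capacities s S n)) = ν.planMean π := by
  induction π generalizing S T n with
  | finish => simp [planAttempts, bernoulliExp, planMean]
  | probe i t x y ihx ihy =>
    obtain ⟨hi, ht, he, h1, h2⟩ := h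
    have hcard := Finset.card_erase_of_mem ht
    have hpos : 0 < T.card := Finset.card_pos.2 ⟨t, ht⟩
    obtain ⟨k, hk⟩ : ∃ k, n i = k + 1 := ⟨n i - 1, by have := (hn i).1; omega⟩
    have hkm : k < m := by have := (hn i).2; omega
    have hn' : ∀ j, (T.erase t).card ≤ n j ∧ n j ≤ m := fun j => by
      have := hn j; omega
    have hn'' : ∀ j, (T.erase t).card ≤ Function.update n i k j ∧
        Function.update n i k j ≤ m := fun j => by
      by_cases hj : j = i
      · subst hj; have := hn j; simp; omega
      · simpa [hj] using hn' j
    set w : I → ℝ := fun i => a i * ν.weight i with hw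
    let X : (Fin m ⊕ I × Fin m → Bool) → ℝ := fun s =>
      planAttempts w (fun t => s (.inl t)) x (capacities s (S.erase i) n)
    let Y : (Fin m ⊕ I × Fin m → Bool) → ℝ := fun s =>
      planAttempts w (fun t => s (.inl t)) y (capacities s S (Function.update n i k))
    let Z : (Fin m ⊕ I × Fin m → Bool) → ℝ := fun s =>
      planAttempts w (fun t => s (.inl t)) y (capacities s S n)
    -- one step of the plan in terms of the coin of `t` and the next coin of `i`
    have hstep : (fun s => planAttempts w (fun t => s (.inl t)) (.probe i t x y)
        (capacities s S n)) = fun s => if s (.inl t) then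
          w i + (if s (.inr (i, ⟨k, hkm⟩)) then X s else Y s) else Z s := by
      funext s
      have hc : capacities s S n i =
          if s (.inr (i, ⟨k, hkm⟩)) then 1 else capacity s i k + 1 := by
        simp [capacities, hi, hk, capacity, hkm]
      have hX : Function.update (capacities s S n) i 0 = capacities s (S.erase i) n := by
        funext j
        by_cases hj : j = i
        · subst hj; simp [capacities]
        · simp [capacities, hj]
      have hY : Function.update (capacities s S n) i (capacity s i k) =
          capacities s S (Function.update n i k) := by
        funext j
        by_cases hj : j = i
        · subst hj; simp [capacities, hi]
        · simp [capacities, hj]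
      have hp := capacity_pos s i k
      simp only [planAttempts, X, Y, Z, hX]
      rw [hc]
      by_cases hs : s (.inr (i, ⟨k, hkm⟩)) = true
      · simp [hs]
      · simp [hs, hY, hp.ne']
    -- the coin of `t` is not used again
    have hlive : ∀ (s : Fin m ⊕ I × Fin m → Bool) (c : Bool), ∀ u ∈ T.erase t,
        Function.update s (.inl t) c (.inl u) = s (.inl u) := fun s c u hu => by
      simp [Finset.ne_of_mem_erase hu]
    have hcap : ∀ (s : Fin m ⊕ I × Fin m → Bool) (c : Bool) S n,
        capacities (Function.update s (.inl t) c) S n = capacities s S n := fun s c S n => by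
      funext j
      unfold capacities
      rw [capacity_congr (s' := s) j (n j) fun _ _ _ => by simp]
    have hXt : ∀ s c, X (Function.update s (.inl t) c) = X s := fun s c => by
      simp only [X, hcap]
      exact ν.planAttempts_congr w x _ _ h1 (hlive s c) _
    have hYt : ∀ s c, Y (Function.update s (.inl t) c) = Y s := fun s c => by
      simp only [Y, hcap]
      exact ν.planAttempts_congr w y _ _ h2 (hlive s c) _
    have hZt : ∀ s c, Z (Function.update s (.inl t) c) = Z s := fun s c => by
      simp only [Z, hcap]
      exact ν.planAttempts_congr w y _ _ h2 (hlive s c) _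
    -- the coin of `i` is not used again
    have hXi : ∀ s c, X (Function.update s (.inr (i, ⟨k, hkm⟩)) c) = X s := fun s c => by
      have : capacities (Function.update s (.inr (i, ⟨k, hkm⟩)) c) (S.erase i) n =
          capacities s (S.erase i) n := by
        funext j
        by_cases hj : j = i
        · simp [capacities, hj]
        · unfold capacities
          rw [capacity_congr (s' := s) j (n j) fun _ _ _ => by simp [hj]]
      simp only [X, this]
      exact ν.planAttempts_congr w x _ _ h1 (fun u _ => by simp) _
    have hYi : ∀ s c, Y (Function.update s (.inr (i, ⟨k, hkm⟩)) c) = Y s := fun s c => by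
      have : capacities (Function.update s (.inr (i, ⟨k, hkm⟩)) c) S (Function.update n i k) =
          capacities s S (Function.update n i k) := by
        funext j
        unfold capacities
        rw [capacity_congr (s' := s) j]
        intro l hl hlk
        by_cases hj : j = i
        · subst hj
          rw [Function.update_self] at hlk
          simp [hlk.ne]
        · simp [hj]
      simp only [Y, this]
      exact ν.planAttempts_congr w y _ _ h2 (fun u _ => by simp) _
    have hne : ∀ (s : Fin m ⊕ I × Fin m → Bool) (c : Bool),
        Function.update s (.inl t) c (.inr (i, ⟨k, hkm⟩)) = s (.inr (i, ⟨k, hkm⟩)) :=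
      fun s c => by simp
    rw [hstep, bernoulliExp_ite _ (.inl t)
        (fun s => w i + (if s (.inr (i, ⟨k, hkm⟩)) then X s else Y s)) Z
        (fun s c => by simp only [hXt, hYt, hne]) hZt,
      bernoulliExp_const_add, bernoulliExp_ite _ _ X Y hXi hYi]
    rw [show bernoulliExp _ X = _ from ihx _ _ n h1 hn',
      show bernoulliExp _ Y = _ from ihy _ _ _ h2 hn'',
      show bernoulliExp _ Z = _ from ihy _ _ n h2 hn', planMean, hab i t he]
    simp only [Sum.elim_inl, Sum.elim_inr, hw]
    ring

/-! ### The attempts of a plan form a matching within the capacities -/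

theorem exists_matching_planAttempts (ν : StochasticMatching I m) (w : I → ℝ)
    (live : Fin m → Bool) (π : OfflinePlan I m) (S : Finset I) (T : Finset (Fin m))
    (r : I → ℕ) (h : ν.Feasible π S T) (hr : ∀ i, 0 < r i ↔ i ∈ S) :
    ∃ M : Fin m → Option I,
      (∀ t i, M t = some i → t ∈ T ∧ live t ∧ (i, t) ∈ ν.edges) ∧
      (∀ i, (Finset.univ.filter fun t => M t = some i).card ≤ r i) ∧
      planAttempts w live π r = ∑ t, (M t).elim 0 w := by
  induction π generalizing S T r with
  | finish => exact ⟨fun _ => none, by simp, by simp, by simp [planAttempts]⟩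
  | probe i t a b iha ihb =>
    obtain ⟨hi, ht, he, h1, h2⟩ := h
    by_cases hl : live t
    swap
    · obtain ⟨M, hM, hc, hs⟩ := ihb _ _ r h2 hr
      refine ⟨M, fun u j hu => ⟨Finset.mem_of_mem_erase (hM u j hu).1, (hM u j hu).2⟩, hc, ?_⟩
      rw [← hs]
      simp [planAttempts, hl]
    have hri := (hr i).2 hi
    -- in both cases, the attempt is added to the matching of the remaining plan
    have key : ∃ M : Fin m → Option I,
        (∀ t' i, M t' = some i → t' ∈ T.erase t ∧ live t' ∧ (i, t') ∈ ν.edges) ∧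
        (∀ j, (Finset.univ.filter fun t => M t = some j).card ≤
          Function.update r i (r i - 1) j) ∧
        planAttempts w live (.probe i t a b) r = w i + ∑ t, (M t).elim 0 w := by
      by_cases h1' : r i = 1
      · obtain ⟨M, hM, hc, hs⟩ := iha _ _ (Function.update r i 0) h1 fun j => by
          by_cases hj : j = i
          · subst hj; simp
          · simp [hj, hr]
        refine ⟨M, hM, by simpa [h1'] using hc, ?_⟩
        rw [← hs]
        simp [planAttempts, hl, h1']
      · obtain ⟨M, hM, hc, hs⟩ := ihb _ _ (Function.update r i (r i - 1)) h2 fun j => by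
          by_cases hj : j = i
          · subst hj; simp [hi]; omega
          · simp [hj, hr]
        refine ⟨M, hM, hc, ?_⟩
        rw [← hs]
        simp [planAttempts, hl, h1']
    obtain ⟨M, hM, hc, hs⟩ := key
    have hMt : M t = none := by
      by_contra hne
      obtain ⟨j, hj⟩ := Option.ne_none_iff_exists'.1 hne
      exact absurd (hM t j hj).1 (Finset.notMem_erase t T)
    refine ⟨Function.update M t (some i), fun u j hu => ?_, fun j => ?_, ?_⟩
    · by_cases hut : u = t
      · subst hut
        simp only [Function.update_self, Option.some.injEq] at hu
        subst hu
        exact ⟨ht, hl, he⟩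
      · rw [Function.update_of_ne hut] at hu
        exact ⟨Finset.mem_of_mem_erase (hM u j hu).1, (hM u j hu).2⟩
    · have hj' := hc j
      by_cases hj : j = i
      · subst hj
        have hsub : (Finset.univ.filter fun u => Function.update M t (some j) u = some j) ⊆
            insert t (Finset.univ.filter fun u => M u = some j) := fun u hu => by
          by_cases hut : u = t
          · simp [hut]
          · simpa [hut] using hu
        have := (Finset.card_le_card hsub).trans (Finset.card_insert_le _ _)
        rw [Function.update_self] at hj'
        omega
      · rw [Function.update_of_ne hj] at hj'
        refine (Finset.card_le_card fun u hu => ?_).trans hj'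
        by_cases hut : u = t
        · subst hut; simp [Ne.symm hj] at hu
        · simpa [hut] using hu
    · rw [hs, ← Finset.add_sum_erase _ _ (Finset.mem_univ t),
        ← Finset.add_sum_erase (Finset.univ) (fun u => (Function.update M t (some i) u).elim 0 w)
          (Finset.mem_univ t)]
      simp only [hMt, Function.update_self, Option.elim_none, Option.elim_some, zero_add]
      congr 1
      refine Finset.sum_congr rfl fun u hu => ?_
      rw [Function.update_of_ne (Finset.ne_of_mem_erase hu)]

/-! ### Greedy matching with capacities -/

/-- The plan that processes a list of arrivals and offers to each arrival `t` the resource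
`offer S t`, where `S` is the set of available resources. -/
def greedyPlan (offer : Finset I → Fin m → Option I) :
    List (Fin m) → Finset I → OfflinePlan I m
  | [], _ => .finish
  | t :: ts, S =>
    match offer S t with
    | none => greedyPlan offer ts S
    | some i => .probe i t (greedyPlan offer ts (S.erase i)) (greedyPlan offer ts S)

theorem planReward_greedyPlan (ν : StochasticMatching I m) (tie : TieBreaking I m)
    (y : I → unitInterval) (s : I × Fin m → Bool) (ts : List (Fin m)) (S : Finset I) :
    ν.planReward s (greedyPlan (ν.greedyOffer tie y) ts S) = ν.greedyReward tie y s ts S := by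
  induction ts generalizing S with
  | nil => rfl
  | cons t ts ih =>
    unfold greedyPlan greedyReward
    cases ν.greedyOffer tie y S t with
    | none => exact ih S
    | some i => simp only [planReward, ih]

theorem feasible_greedyPlan (ν : StochasticMatching I m) {offer : Finset I → Fin m → Option I}
    (ho : ∀ S t i, offer S t = some i → i ∈ S ∧ (i, t) ∈ ν.edges)
    (ts : List (Fin m)) (hts : ts.Nodup) (S : Finset I) (T : Finset (Fin m))
    (hT : ∀ t ∈ ts, t ∈ T) : ν.Feasible (greedyPlan offer ts S) S T := by
  induction ts generalizing S T with
  | nil => trivial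
  | cons t ts ih =>
    obtain ⟨ht, hts⟩ := List.nodup_cons.1 hts
    have hT' : ∀ u ∈ ts, u ∈ T.erase t := fun u hu =>
      Finset.mem_erase.2 ⟨fun h => ht (h ▸ hu), hT u (List.mem_cons_of_mem _ hu)⟩
    unfold greedyPlan
    split
    · exact ih hts _ _ fun u hu => hT u (List.mem_cons_of_mem _ hu)
    · next i hi =>
      exact ⟨(ho _ _ _ hi).1, hT t List.mem_cons_self, (ho _ _ _ hi).2,
        ih hts _ _ hT', ih hts _ _ hT'⟩

/-- The capacities after a unit of the offered resource is used. -/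
def useUnit (r : I → ℕ) (o : Option I) (j : I) : ℕ :=
  if o = some j then r j - 1 else r j

/-- The matching of the live arrivals in a list that offers to each of them the resource
`offer S t`, where `S` is the set of resources with a positive remaining capacity. -/
def greedyMatch (offer : Finset I → Fin m → Option I) (live : Fin m → Bool) :
    List (Fin m) → (I → ℕ) → Fin m → Option I
  | [], _ => fun _ => none
  | t :: ts, r =>
    if live t then
      Function.update
        (greedyMatch offer live ts (useUnit r (offer (Finset.univ.filter fun i => 0 < r i) t)))
        t (offer (Finset.univ.filter fun i => 0 < r i) t)
    else greedyMatch offer live ts r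

theorem greedyMatch_of_notMem (offer : Finset I → Fin m → Option I) (live : Fin m → Bool)
    (ts : List (Fin m)) (r : I → ℕ) {t : Fin m} (ht : t ∉ ts) :
    greedyMatch offer live ts r t = none := by
  induction ts generalizing r with
  | nil => rfl
  | cons u ts ih =>
    obtain ⟨htu, ht⟩ := not_or.1 (List.mem_cons.not.1 ht)
    unfold greedyMatch
    split_ifs
    · rw [Function.update_of_ne htu, ih _ ht]
    · exact ih _ ht

/-- On presampled capacities, the greedy plan makes the attempts of the greedy matching. -/
theorem planAttempts_greedyPlan (ν : StochasticMatching I m)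
    {offer : Finset I → Fin m → Option I}
    (ho : ∀ S t i, offer S t = some i → i ∈ S ∧ (i, t) ∈ ν.edges) (w : I → ℝ)
    (live : Fin m → Bool) (ts : List (Fin m)) (hts : ts.Nodup) (r : I → ℕ) :
    planAttempts w live (greedyPlan offer ts (Finset.univ.filter fun i => 0 < r i)) r =
      ∑ t, (greedyMatch offer live ts r t).elim 0 w := by
  induction ts generalizing r with
  | nil => simp [greedyPlan, planAttempts, greedyMatch]
  | cons t ts ih =>
    obtain ⟨ht, hts⟩ := List.nodup_cons.1 hts
    unfold greedyPlan greedyMatch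
    by_cases hl : live t
    swap
    · simp only [hl]
      split
      · simpa using ih hts r
      · simpa [planAttempts, hl] using ih hts r
    have hsum : ∀ r', (∑ u, (Function.update (greedyMatch offer live ts r') t
        (offer (Finset.univ.filter fun i => 0 < r i) t) u).elim 0 w) =
        (offer (Finset.univ.filter fun i => 0 < r i) t).elim 0 w +
          ∑ u, (greedyMatch offer live ts r' u).elim 0 w := fun r' => by
      rw [← Finset.add_sum_erase _ _ (Finset.mem_univ t),
        ← Finset.add_sum_erase Finset.univ (fun u => (greedyMatch offer live ts r' u).elim 0 w)
          (Finset.mem_univ t), greedyMatch_of_notMem offer live ts r' ht]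
      simp only [Function.update_self, Option.elim_none, zero_add]
      congr 1
      refine Finset.sum_congr rfl fun u hu => ?_
      rw [Function.update_of_ne (Finset.ne_of_mem_erase hu)]
    simp only [hl, if_true]
    rw [hsum]
    cases h : offer (Finset.univ.filter fun i => 0 < r i) t with
    | none =>
      have : useUnit r none = r := by funext j; simp [useUnit]
      simpa [this] using ih hts r
    | some i =>
      have hi : 0 < r i := by simpa using (ho _ _ _ h).1
      have hu : useUnit r (some i) = Function.update r i (r i - 1) := by
        funext j
        by_cases hj : j = i
        · subst hj; simp [useUnit]
        · simp [useUnit, hj, Ne.symm hj]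
      simp only [planAttempts, hl, if_true, Option.elim_some, add_right_inj]
      rw [← ih hts, hu]
      by_cases h1 : r i = 1
      · have : (Finset.univ.filter fun j => 0 < Function.update r i 0 j) =
            (Finset.univ.filter fun j => 0 < r j).erase i := by
          ext j
          by_cases hj : j = i
          · subst hj; simp
          · simp [hj]
        simp [h1, this]
      · have : (Finset.univ.filter fun j => 0 < Function.update r i (r i - 1) j) =
            (Finset.univ.filter fun j => 0 < r j) := by
          ext j
          by_cases hj : j = i
          · subst hj; simp; omega
          · simp [hj]
        simp [h1, this]

/-! ### Comparison of the greedy matchings with and without a resource -/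

/-- The offers are greedy with respect to the values `v` of the resources: they are available
neighbors, and no available neighbor has a higher value. Making no offer has the value `0`, so this
allows an arrival to remain unmatched when all its available neighbors have the value `0`. -/
def IsGreedy (ν : StochasticMatching I m) (v : I → ℝ) (live : Fin m → Bool)
    (offer : Finset I → Fin m → Option I) : Prop :=
  (∀ S t i, offer S t = some i → i ∈ S ∧ (i, t) ∈ ν.edges) ∧
    ∀ S t i, live t → i ∈ S → (i, t) ∈ ν.edges → v i ≤ (offer S t).elim 0 v

/-- Let `r` and `q` be capacities such that `q i = 0`, `q ≤ r` on resources of positive value, and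
`q = r` on resources of a higher value than `i`. If there are no ties between positive values,
then the greedy matching for `r` gives every arrival at least the value that it has in the
greedy matching for `q`, and it uses `i` at all neighbors of `i` whose value for `q` is below
that of `i`, as long as the capacity of `i` lasts. The relations between `r` and `q` are invariant
along the run: when the first run takes a resource of positive value and the second one does not
take the same, the second one has none of it left. -/
theorem greedyMatch_compare (ν : StochasticMatching I m) {v : I → ℝ} (hv : ∀ i, 0 ≤ v i)
    (hgen : ∀ j k, j ≠ k → v j = v k → v j = 0) {live : Fin m → Bool}
    {offer : Finset I → Fin m → Option I} (hoff : ν.IsGreedy v live offer) {i : I}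
    (hi : 0 < v i) (ts : List (Fin m)) (hts : ts.Nodup) (r q : I → ℕ)
    (h0 : q i = 0) (hle : ∀ j, 0 < v j → q j ≤ r j) (heq : ∀ j, v i < v j → q j = r j) :
    (∀ t, (greedyMatch offer live ts q t).elim 0 v ≤ (greedyMatch offer live ts r t).elim 0 v) ∧
      min (r i) (Finset.univ.filter fun t => t ∈ ts ∧ live t ∧ (i, t) ∈ ν.edges ∧
          (greedyMatch offer live ts q t).elim 0 v < v i).card ≤
        (Finset.univ.filter fun t => greedyMatch offer live ts r t = some i).card := by
  induction ts generalizing r q with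
  | nil => simp [greedyMatch]
  | cons t ts ih =>
    obtain ⟨ht, hts⟩ := List.nodup_cons.1 hts
    unfold greedyMatch
    by_cases hl : live t
    swap
    · obtain ⟨ih1, ih2⟩ := ih hts r q h0 hle heq
      simp only [hl, Bool.false_eq_true, if_false]
      refine ⟨ih1, le_trans (min_le_min le_rfl (Finset.card_le_card fun u hu => ?_)) ih2⟩
      simp only [Finset.mem_filter, Finset.mem_univ, true_and, List.mem_cons] at hu ⊢
      obtain ⟨rfl | hu', hu⟩ := hu
      · exact absurd hu.1 hl
      · exact ⟨hu', hu⟩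
    simp only [hl, if_true]
    obtain ⟨hmem, hmax⟩ := hoff
    -- `x` and `z` are the offers in the two runs
    obtain ⟨x, hx⟩ : ∃ x, x = offer (Finset.univ.filter fun i => 0 < r i) t := ⟨_, rfl⟩
    obtain ⟨z, hz⟩ : ∃ z, z = offer (Finset.univ.filter fun i => 0 < q i) t := ⟨_, rfl⟩
    rw [← hx, ← hz]
    have xmem : ∀ j, x = some j → 0 < r j ∧ (j, t) ∈ ν.edges := fun j hj => by
      simpa using hmem _ t j (hx.symm.trans hj)
    have zmem : ∀ j, z = some j → 0 < q j ∧ (j, t) ∈ ν.edges := fun j hj => by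
      simpa using hmem _ t j (hz.symm.trans hj)
    have xmax : ∀ j, 0 < r j → (j, t) ∈ ν.edges → v j ≤ x.elim 0 v := fun j hj he => by
      rw [hx]; exact hmax _ t j hl (by simpa using hj) he
    have zmax : ∀ j, 0 < q j → (j, t) ∈ ν.edges → v j ≤ z.elim 0 v := fun j hj he => by
      rw [hz]; exact hmax _ t j hl (by simpa using hj) he
    clear hx hz
    have huniq : ∀ (o : Option I) j, 0 < v j → o.elim 0 v = v j → o = some j := by
      rintro (_ | k) j hj h
      · simp at h; exact absurd h hj.ne
      · by_contra hne
        have hkj : j ≠ k := fun h => hne (by rw [h])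
        exact hj.ne' (hgen j k hkj h.symm)
    have hzx : z.elim 0 v ≤ x.elim 0 v := by
      rcases z with _ | k
      · rcases x with _ | k
        · simp
        · simpa using hv k
      · obtain ⟨hk, he⟩ := zmem k rfl
        rcases (hv k).eq_or_lt with hk0 | hk0
        · rcases x with _ | l
          · simp [← hk0]
          · simpa [← hk0] using hv l
        · exact xmax k (hk.trans_le (hle k hk0)) he
    -- a resource that is taken in the first run is taken in the second run, too, if it is left there
    have hxz : ∀ j, 0 < v j → x = some j → 0 < q j → z = some j := fun j hj hxj hq => by
      refine huniq z j hj (le_antisymm ?_ (zmax j hq (xmem j hxj).2))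
      simpa [hxj] using hzx
    obtain ⟨ih1, ih2⟩ := ih hts (useUnit r x) (useUnit q z)
      (by simp [useUnit, h0])
      (fun j hj => by
        have := hle j hj
        have := hxz j hj
        unfold useUnit
        split_ifs with hz hx hx
        · omega
        · omega
        · have : ¬ 0 < q j := fun hq => hz (hxz j hj hx hq)
          omega
        · omega)
      (fun j hj => by
        have hj0 := hi.trans hj
        have hqr := heq j hj
        have h2 : z = some j → x = some j := fun hzj => by
          obtain ⟨hq, he⟩ := zmem j hzj
          have hvx := xmax j (hqr ▸ hq) he
          rcases hxe : x with _ | k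
          · rw [hxe] at hvx; exact absurd hvx (not_le.2 hj0)
          rw [hxe] at hvx
          obtain ⟨hk, hke⟩ := xmem k hxe
          have := zmax k (by rw [heq k (hj.trans_le hvx)]; exact hk) hke
          rw [hzj] at this
          rw [← hxe]
          refine huniq x j hj0 (le_antisymm ?_ (by rw [hxe]; exact hvx))
          rw [hxe]; exact this
        have h1 : x = some j → z = some j := fun hxj =>
          hxz j hj0 hxj (hqr ▸ (xmem j hxj).1)
        unfold useUnit
        by_cases hx : x = some j
        · simp [hx, h1 hx, hqr]
        · simp [hx, mt h2 hx, hqr])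
    refine ⟨fun u => ?_, ?_⟩
    · by_cases hut : u = t
      · subst hut; simpa using hzx
      · simpa [hut] using ih1 u
    -- an arrival that prefers `i` to its match in the second run is matched to `i` in the first
    have htake : (i, t) ∈ ν.edges → z.elim 0 v < v i → 0 < r i → x = some i := fun he hlt hr => by
      have hvx := xmax i hr he
      rcases hxe : x with _ | k
      · rw [hxe] at hvx; exact absurd hvx (not_le.2 hi)
      rw [hxe] at hvx
      obtain ⟨hk, hke⟩ := xmem k hxe
      rcases hvx.eq_or_lt with h | h
      · rw [← hxe]; exact huniq x i hi (by rw [hxe]; exact h.symm)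
      · have := zmax k (by rw [heq k h]; exact hk) hke
        have h' : v i < v k := h
        linarith
    set A := Finset.univ.filter fun u => u ∈ ts ∧ live u ∧ (i, u) ∈ ν.edges ∧
      (greedyMatch offer live ts (useUnit q z) u).elim 0 v < v i with hA
    set N := Finset.univ.filter fun u => greedyMatch offer live ts (useUnit r x) u = some i with hN
    have hNt : t ∉ N := by simp [hN, greedyMatch_of_notMem offer live ts _ ht]
    have hA' : (Finset.univ.filter fun u => u ∈ t :: ts ∧ live u ∧ (i, u) ∈ ν.edges ∧
        (Function.update (greedyMatch offer live ts (useUnit q z)) t z u).elim 0 v < v i) ⊆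
        insert t A := fun u hu => by
      by_cases hut : u = t
      · simp [hut]
      · simpa [hA, hut] using hu
    by_cases hxi : x = some i
    · have hN' : (Finset.univ.filter fun u =>
          Function.update (greedyMatch offer live ts (useUnit r x)) t x u = some i) =
          insert t N := by
        ext u
        by_cases hut : u = t
        · simp [hut, hxi]
        · simp [hN, hut]
      rw [hN', Finset.card_insert_of_notMem hNt]
      have h1 := (Finset.card_le_card hA').trans (Finset.card_insert_le _ _)
      have h2 : useUnit r x i = r i - 1 := by simp [useUnit, hxi]
      rw [h2] at ih2
      omega
    · have hN' : (Finset.univ.filter fun u =>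
          Function.update (greedyMatch offer live ts (useUnit r x)) t x u = some i) = N := by
        ext u
        by_cases hut : u = t
        · subst hut; simpa [hxi] using hNt
        · simp [hN, hut]
      rw [hN']
      have h2 : useUnit r x i = r i := by simp [useUnit, hxi]
      rw [h2] at ih2
      rcases Nat.eq_zero_or_pos (r i) with hr | hr
      · simp [hr]
      refine le_trans (min_le_min le_rfl (Finset.card_le_card fun u hu => ?_)) ih2
      by_cases hut : u = t
      · subst hut
        simp only [Finset.mem_filter, Function.update_self] at hu
        exact absurd (htake hu.2.2.2.1 hu.2.2.2.2 hr) hxi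
      · simpa [hA, hut] using hu

end StochasticMatching

/-! ### Integration over the seeds -/

/-- Resampling one coordinate does not change a product of uniform distributions. -/
theorem measurePreserving_update_unitInterval {I : Type*} [Fintype I] [DecidableEq I] (i : I) :
    MeasurePreserving (fun x : (I → unitInterval) × unitInterval => Function.update x.1 i x.2)
      (volume.prod volume) volume := by
  have hm : Measurable fun x : (I → unitInterval) × unitInterval =>
      Function.update x.1 i x.2 := by
    refine measurable_pi_iff.2 fun j => ?_
    by_cases hj : j = i
    · subst hj; simpa using measurable_snd
    · simp only [Function.update_of_ne hj]; fun_prop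
  refine ⟨hm, (Measure.pi_eq fun s hs => ?_).symm⟩
  have hpre : (fun x : (I → unitInterval) × unitInterval => Function.update x.1 i x.2) ⁻¹'
      Set.univ.pi s = (Set.univ.pi (Function.update s i Set.univ)) ×ˢ s i := by
    ext ⟨y, z⟩
    simp only [Set.mem_preimage, Set.mem_pi, Set.mem_univ, true_implies, Set.mem_prod]
    constructor
    · refine fun h => ⟨fun j => ?_, by simpa using h i⟩
      by_cases hj : j = i
      · subst hj; simp
      · simpa [hj] using h j
    · rintro ⟨h, hz⟩ j
      by_cases hj : j = i
      · subst hj; simpa using hz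
      · simpa [hj] using h j
  rw [Measure.map_apply hm (MeasurableSet.univ_pi hs), hpre, Measure.prod_prod, volume_pi,
    Measure.pi_pi, ← Finset.mul_prod_erase _ _ (Finset.mem_univ i),
    ← Finset.mul_prod_erase Finset.univ (fun j => volume (s j)) (Finset.mem_univ i)]
  have : ∏ j ∈ Finset.univ.erase i, volume (Function.update s i Set.univ j) =
      ∏ j ∈ Finset.univ.erase i, volume (s j) := Finset.prod_congr rfl fun j hj => by
    rw [Function.update_of_ne (Finset.ne_of_mem_erase hj)]
  rw [this, Function.update_self, measure_univ, one_mul, mul_comm]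

theorem integrable_seed_gain (w l : ℝ) :
    Integrable fun z : unitInterval =>
      if l < w * (1 - Real.exp ((z : ℝ) - 1)) then w * Real.exp ((z : ℝ) - 1) else 0 := by
  have hc : Continuous fun z : unitInterval => w * Real.exp ((z : ℝ) - 1) := by fun_prop
  have hs : MeasurableSet {z : unitInterval | l < w * (1 - Real.exp ((z : ℝ) - 1))} :=
    (isOpen_lt continuous_const (by fun_prop)).measurableSet
  exact (hc.integrable_of_hasCompactSupport (HasCompactSupport.of_compactSpace _)).indicator hs

/-- The dual inequality of the exponential perturbation: an arrival that is worth `l` without a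
resource of weight `w`, and is taken by this resource whenever the seed `z` makes it worth more,
accounts together with this resource for at least `(1 - 1 / e) * w` on average. -/
theorem le_integral_seed_gain {w l : ℝ} (hw : 0 < w) (hl : 0 ≤ l) :
    (1 - 1 / Real.exp 1) * w ≤ l + ∫ z : unitInterval,
      if l < w * (1 - Real.exp ((z : ℝ) - 1)) then w * Real.exp ((z : ℝ) - 1) else 0 := by
  have hnn : 0 ≤ ∫ z : unitInterval,
      if l < w * (1 - Real.exp ((z : ℝ) - 1)) then w * Real.exp ((z : ℝ) - 1) else 0 :=
    integral_nonneg fun z => by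
      dsimp only
      split_ifs
      · positivity
      · exact le_rfl
  have he : 1 / Real.exp 1 = Real.exp (-1) := by rw [Real.exp_neg, one_div]
  rw [he]
  by_cases hlw : (1 - Real.exp (-1)) * w ≤ l
  · linarith
  have hlw' : Real.exp (-1) < 1 - l / w := by
    have : l / w < 1 - Real.exp (-1) := by rw [div_lt_iff₀ hw]; exact not_le.1 hlw
    linarith
  have hpos : 0 < 1 - l / w := (Real.exp_pos _).trans hlw'
  -- the seed at which the resource is worth exactly `l`
  obtain ⟨c, hc⟩ : ∃ c, c = 1 + Real.log (1 - l / w) := ⟨_, rfl⟩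
  have hexp : Real.exp (c - 1) = 1 - l / w := by
    rw [hc, add_sub_cancel_left, Real.exp_log hpos]
  have hc0 : 0 ≤ c := by
    have : (-1 : ℝ) ≤ c - 1 := Real.exp_le_exp.1 (hexp ▸ hlw'.le)
    linarith
  have hc1 : c ≤ 1 := by
    have : c - 1 ≤ 0 := Real.exp_le_one_iff.1 (by rw [hexp]; linarith [div_nonneg hl hw.le])
    linarith
  have hiff : ∀ x : ℝ, l < w * (1 - Real.exp (x - 1)) ↔ x < c := fun x => by
    rw [show x < c ↔ Real.exp (x - 1) < Real.exp (c - 1) by simp, hexp, ← div_lt_iff₀' hw]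
    constructor <;> intro h <;> linarith
  have hint : (∫ z : unitInterval,
      if l < w * (1 - Real.exp ((z : ℝ) - 1)) then w * Real.exp ((z : ℝ) - 1) else 0) =
      ∫ x in (0 : ℝ)..c, w * Real.exp (x - 1) := by
    rw [unitInterval.measurePreserving_coe.integral_comp unitInterval.measurableEmbedding_coe
      (fun x : ℝ => if l < w * (1 - Real.exp (x - 1)) then w * Real.exp (x - 1) else 0)]
    have hind : (fun x : ℝ => if l < w * (1 - Real.exp (x - 1)) then w * Real.exp (x - 1) else 0) =
        (Set.Iio c).indicator fun x => w * Real.exp (x - 1) := by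
      funext x
      simp [Set.indicator, hiff]
    have hset : Set.Iio c ∩ unitInterval = Set.Ico 0 c := by
      ext x
      simp only [Set.mem_inter_iff, Set.mem_Iio, Set.mem_Icc, Set.mem_Ico]
      constructor
      · rintro ⟨h1, h2, -⟩; exact ⟨h2, h1⟩
      · rintro ⟨h1, h2⟩; exact ⟨h2, h1, h2.le.trans hc1⟩
    rw [hind, integral_indicator measurableSet_Iio, Measure.restrict_restrict measurableSet_Iio,
      hset, intervalIntegral.integral_of_le hc0, integral_Ico_eq_integral_Ioo,
      integral_Ioc_eq_integral_Ioo]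
  have hval : ∫ x in (0 : ℝ)..c, w * Real.exp (x - 1) = w * (Real.exp (c - 1) - Real.exp (-1)) := by
    rw [intervalIntegral.integral_const_mul,
      intervalIntegral.integral_comp_sub_right (fun x => Real.exp x), integral_exp]
    simp
  rw [hint, hval, hexp]
  have hlw0 : w * (l / w) = l := by field_simp
  linarith

theorem elim_eq_sum {I : Type*} [Fintype I] [DecidableEq I] (o : Option I) (f : I → ℝ) :
    o.elim 0 f = ∑ i, if o = some i then f i else 0 := by
  cases o <;> simp

namespace StochasticMatching

variable {I : Type*} [Fintype I] [DecidableEq I] {m : ℕ}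

/-- The perturbed value of resource `i`: its weight `w i`, reduced by the share `exp (y i - 1)`. -/
noncomputable def seedValue (w : I → ℝ) (y : I → unitInterval) (i : I) : ℝ :=
  w i * (1 - Real.exp ((y i : ℝ) - 1))

theorem seedValue_nonneg {w : I → ℝ} (hw : ∀ i, 0 ≤ w i) (y : I → unitInterval) (i : I) :
    0 ≤ seedValue w y i :=
  mul_nonneg (hw i) (by
    have := Real.exp_le_one_iff.2 (show ((y i : ℝ) - 1) ≤ 0 by linarith [(y i).2.2])
    linarith)

theorem seedValue_update_of_ne (w : I → ℝ) (y : I → unitInterval) {i j : I} (z : unitInterval)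
    (h : j ≠ i) : seedValue w (Function.update y i z) j = seedValue w y j := by
  simp [seedValue, h]

theorem greedyOffer_mem (ν : StochasticMatching I m) (tie : TieBreaking I m)
    (y : I → unitInterval) (S : Finset I) (t : Fin m) (i : I)
    (h : ν.greedyOffer tie y S t = some i) :
    i ∈ S ∧ (i, t) ∈ ν.edges := by
  unfold greedyOffer at h
  split_ifs at h with hA
  have := tie.pick_mem t _ hA
  rw [Option.some.inj h] at this
  simpa [greedyArgmax, candidates] using (Finset.mem_filter.1 this).1

/-- The probability of the arrival scales the perturbed rewards of all its neighbors alike, so that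
Perturbed Greedy compares values that do not depend on the arrival. This breaks down when an
arrival never succeeds, but such an arrival is not live. -/
theorem isGreedy_greedyOffer (ν : StochasticMatching I m) (tie : TieBreaking I m) {a : I → ℝ}
    {b : Fin m → ℝ} (hab : ∀ i t, (i, t) ∈ ν.edges → ν.prob i t = a i * b t)
    {live : Fin m → Bool} (hb : ∀ t, live t → 0 < b t) (y : I → unitInterval) :
    ν.IsGreedy (seedValue (fun i => a i * ν.weight i) y) live (ν.greedyOffer tie y) := by
  refine ⟨ν.greedyOffer_mem tie y, fun S t i hl hi he => ?_⟩
  have hr : ∀ j, (j, t) ∈ ν.edges → ν.perturbedReward y t j =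
      b t * seedValue (fun i => a i * ν.weight i) y j := fun j hj => by
    rw [perturbedReward, hab j t hj, seedValue]; ring
  have hmem : i ∈ ν.candidates S t := by simp [candidates, hi, he]
  have hA : (ν.greedyArgmax y S t).Nonempty := by
    obtain ⟨k, hk, hmax⟩ := Finset.exists_max_image _ (ν.perturbedReward y t) ⟨i, hmem⟩
    exact ⟨k, Finset.mem_filter.2 ⟨hk, hmax⟩⟩
  have hpick := tie.pick_mem t _ hA
  obtain ⟨hk, hmax⟩ := Finset.mem_filter.1 hpick
  have hke := (Finset.mem_filter.1 hk).2
  have := hmax i hmem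
  rw [hr i he, hr _ hke] at this
  rw [greedyOffer, dif_pos hA]
  exact le_of_mul_le_mul_left this (hb t hl)

theorem greedyOffer_update (ν : StochasticMatching I m) (tie : TieBreaking I m)
    (y : I → unitInterval) (i : I) (z : unitInterval) (S : Finset I) (hi : i ∉ S) (t : Fin m) :
    ν.greedyOffer tie (Function.update y i z) S t = ν.greedyOffer tie y S t := by
  have hA : ν.greedyArgmax (Function.update y i z) S t = ν.greedyArgmax y S t := by
    have hr : ∀ j ∈ ν.candidates S t,
        ν.perturbedReward (Function.update y i z) t j = ν.perturbedReward y t j := fun j hj => by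
      have : j ≠ i := fun h => hi (h ▸ (Finset.mem_filter.1 hj).1)
      simp [perturbedReward, this]
    refine Finset.filter_congr fun k hk => forall₂_congr fun j hj => ?_
    rw [hr k hk, hr j hj]
  unfold greedyOffer
  rw [hA]

theorem greedyMatch_congr_of_eq_zero {offer offer' : Finset I → Fin m → Option I} {i : I}
    (h : ∀ S, i ∉ S → ∀ t, offer S t = offer' S t) (live : Fin m → Bool) (ts : List (Fin m))
    (q : I → ℕ) (hq : q i = 0) : greedyMatch offer live ts q = greedyMatch offer' live ts q := by
  induction ts generalizing q with
  | nil => rfl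
  | cons t ts ih =>
    unfold greedyMatch
    rw [h _ (by simp [hq]), ih q hq, ih _ (by simp [useUnit, hq])]

theorem greedyMatch_ne_some {offer : Finset I → Fin m → Option I}
    (ho : ∀ S t j, offer S t = some j → j ∈ S) {i : I} (live : Fin m → Bool) (ts : List (Fin m))
    (q : I → ℕ) (hq : q i = 0) (t : Fin m) : greedyMatch offer live ts q t ≠ some i := by
  induction ts generalizing q with
  | nil => simp [greedyMatch]
  | cons u ts ih =>
    unfold greedyMatch
    split_ifs
    · by_cases ht : t = u
      · subst ht
        rw [Function.update_self]
        exact fun h => by simpa [hq] using ho _ _ _ h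
      · rw [Function.update_of_ne ht]
        exact ih _ (by simp [useUnit, hq])
    · exact ih q hq

/-- As there are finitely many patterns of offers, every property of the offers is measurable. -/
theorem measurableSet_greedyOffer (ν : StochasticMatching I m) (tie : TieBreaking I m)
    (P : (Finset I → Fin m → Option I) → Prop) :
    MeasurableSet {y | P (ν.greedyOffer tie y)} := by
  have hr : ∀ t i, Measurable fun y => ν.perturbedReward y t i := fun t i => by
    refine Continuous.measurable ?_
    unfold perturbedReward
    fun_prop
  have h1 : ∀ S t A, MeasurableSet {y | ν.greedyArgmax y S t = A} := fun S t A => by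
    have : {y | ν.greedyArgmax y S t = A} = ⋂ i, {y | i ∈ ν.greedyArgmax y S t ↔ i ∈ A} := by
      ext y; simp [Finset.ext_iff]
    rw [this]
    refine MeasurableSet.iInter fun i => ?_
    have h2 : MeasurableSet {y | i ∈ ν.greedyArgmax y S t} := by
      have : {y | i ∈ ν.greedyArgmax y S t} = {_y | i ∈ ν.candidates S t} ∩
          ⋂ j, {y | j ∈ ν.candidates S t →
            ν.perturbedReward y t j ≤ ν.perturbedReward y t i} := by
        ext y; simp [greedyArgmax]
      rw [this]
      refine (MeasurableSet.const _).inter (MeasurableSet.iInter fun j => ?_)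
      by_cases hj : j ∈ ν.candidates S t
      · simpa [hj] using measurableSet_le (hr t j) (hr t i)
      · simp [hj]
    by_cases hA : i ∈ A
    · simpa [hA] using h2
    · simp only [hA, iff_false]; exact h2.compl
  have h2 : ∀ o, MeasurableSet {y | ν.greedyOffer tie y = o} := fun o => by
    have : {y | ν.greedyOffer tie y = o} =
        ⋂ S, ⋂ t, {y | ν.greedyOffer tie y S t = o S t} := by
      ext y; simp [funext_iff]
    rw [this]
    refine MeasurableSet.iInter fun S => MeasurableSet.iInter fun t => ?_
    have : {y | ν.greedyOffer tie y S t = o S t} =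
        ⋃ A ∈ {A : Finset I | (if h : A.Nonempty then some (tie.pick t A h) else none) = o S t},
          {y | ν.greedyArgmax y S t = A} := by
      ext y; simp [greedyOffer]
    rw [this]
    exact MeasurableSet.biUnion (Set.to_countable _) fun A _ => h1 S t A
  have : {y | P (ν.greedyOffer tie y)} = ⋃ o ∈ {o | P o}, {y | ν.greedyOffer tie y = o} := by
    ext y; simp
  rw [this]
  exact MeasurableSet.biUnion (Set.to_countable _) fun o _ => h2 o

theorem integrable_greedyMatch (ν : StochasticMatching I m) (tie : TieBreaking I m)
    (live : Fin m → Bool) (ts : List (Fin m)) (r : I → ℕ) (t : Fin m)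
    (u : (I → unitInterval) → I → ℝ) (hu : ∀ i, Continuous fun y => u y i) :
    Integrable fun y => (greedyMatch (ν.greedyOffer tie y) live ts r t).elim 0 (u y) := by
  simp only [elim_eq_sum]
  refine integrable_finsetSum _ fun i _ => ?_
  have h : Integrable fun y => u y i :=
    (hu i).integrable_of_hasCompactSupport (HasCompactSupport.of_compactSpace _)
  refine (h.indicator (ν.measurableSet_greedyOffer tie fun o =>
    greedyMatch o live ts r t = some i)).congr (Filter.Eventually.of_forall fun y => ?_)
  simp [Set.indicator]

/-- Almost surely, there are no ties between perturbed values, except at the value `0`. -/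
theorem ae_seedValue_ne (w : I → ℝ) : ∀ᵐ y : I → unitInterval,
    ∀ j k, j ≠ k → seedValue w y j = seedValue w y k → seedValue w y j = 0 := by
  refine ae_all_iff.2 fun j => ae_all_iff.2 fun k => ?_
  by_cases hjk : j = k
  · exact Filter.Eventually.of_forall fun y h => absurd hjk h
  by_cases hw : w j = 0
  · exact Filter.Eventually.of_forall fun y _ _ => by simp [seedValue, hw]
  have hcont : ∀ i, Continuous fun y : I → unitInterval => seedValue w y i := fun i => by
    unfold seedValue; fun_prop
  have hmeas : MeasurableSet {y : I → unitInterval | seedValue w y j = seedValue w y k} :=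
    (isClosed_eq (hcont j) (hcont k)).measurableSet
  have hnull : volume {y : I → unitInterval | seedValue w y j = seedValue w y k} = 0 := by
    rw [← (measurePreserving_update_unitInterval j).measure_preimage hmeas.nullMeasurableSet,
      Measure.measure_prod_null ((measurePreserving_update_unitInterval j).measurable hmeas)]
    refine Filter.Eventually.of_forall fun y => Set.Subsingleton.measure_zero ?_ _
    intro z hz z' hz'
    have h1 : seedValue w (Function.update y j z) j = seedValue w (Function.update y j z) k := hz
    have h2 : seedValue w (Function.update y j z') j =
      seedValue w (Function.update y j z') k := hz'
    rw [seedValue_update_of_ne _ _ _ (Ne.symm hjk)] at h1 h2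
    have h3 := h1.trans h2.symm
    simp only [seedValue, Function.update_self] at h3
    have h4 := Real.exp_injective (sub_right_injective (mul_left_cancel₀ hw h3))
    exact Subtype.ext (by linarith)
  filter_upwards [compl_mem_ae_iff.2 hnull] with y hy _ h
  exact absurd h hy

/-- Averaged over its own seed, a resource `i` together with any set of its live neighbors that fits
into its capacity receives a `1 - 1 / e` fraction of the weight of this set, when every attempt at
`i` leaves the share `exp (y i - 1)` of its weight with `i` and gives the rest to the arrival. -/
theorem le_integral_greedyMatch (ν : StochasticMatching I m) (tie : TieBreaking I m) {w : I → ℝ}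
    (hw : ∀ i, 0 ≤ w i) {live : Fin m → Bool}
    (hoff : ∀ y, ν.IsGreedy (seedValue w y) live (ν.greedyOffer tie y)) (r : I → ℕ) (i : I)
    (O : Finset (Fin m)) (hO : ∀ t ∈ O, live t ∧ (i, t) ∈ ν.edges) (hcard : O.card ≤ r i) :
    (1 - 1 / Real.exp 1) * (O.card * w i) ≤ ∫ y,
      ((∑ t, (greedyMatch (ν.greedyOffer tie y) live (List.finRange m) r t).elim 0
          fun j => if j = i then w i * Real.exp ((y i : ℝ) - 1) else 0) +
        ∑ t ∈ O, (greedyMatch (ν.greedyOffer tie y) live (List.finRange m) r t).elim 0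
          (seedValue w y)) := by
  set G : (I → unitInterval) → Fin m → Option I := fun y =>
    greedyMatch (ν.greedyOffer tie y) live (List.finRange m) r with hG
  set H : (I → unitInterval) → ℝ := fun y =>
    (∑ t, (G y t).elim 0 fun j => if j = i then w i * Real.exp ((y i : ℝ) - 1) else 0) +
      ∑ t ∈ O, (G y t).elim 0 (seedValue w y) with hH
  change _ ≤ ∫ y, H y
  have hHnn : ∀ y, 0 ≤ H y := fun y => by
    refine add_nonneg (Finset.sum_nonneg fun t _ => ?_) (Finset.sum_nonneg fun t _ => ?_)
    · cases G y t with
      | none => exact le_rfl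
      | some j =>
        simp only [Option.elim_some]
        split_ifs
        · exact mul_nonneg (hw i) (Real.exp_pos _).le
        · exact le_rfl
    · cases G y t with
      | none => exact le_rfl
      | some j => exact seedValue_nonneg hw y j
  rcases (hw i).eq_or_lt with hwi | hwi
  · rw [← hwi]
    simpa using integral_nonneg hHnn
  have hHint : Integrable H := by
    refine (integrable_finsetSum _ fun t _ => ν.integrable_greedyMatch tie live _ r t _
      fun j => ?_).add (integrable_finsetSum _ fun t _ =>
        ν.integrable_greedyMatch tie live _ r t _ fun j => ?_)
    · by_cases hj : j = i
      · simp only [hj, if_true]; fun_prop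
      · simp only [hj, if_false]; fun_prop
    · unfold seedValue; fun_prop
  have hmp := measurePreserving_update_unitInterval i
  have hHint' : Integrable (fun x : (I → unitInterval) × unitInterval =>
      H (Function.update x.1 i x.2)) (volume.prod volume) := hmp.integrable_comp_of_integrable hHint
  -- resample the seed of `i`
  have hfub : ∫ y, H y = ∫ y, ∫ z, H (Function.update y i z) := by
    have h := integral_map (μ := volume.prod volume) hmp.measurable.aemeasurable
      (f := H) (by rw [hmp.map_eq]; exact hHint.1)
    rw [hmp.map_eq] at h
    rw [h, integral_prod _ hHint']
  rw [hfub]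
  have hconst : (1 - 1 / Real.exp 1) * (O.card * w i) =
      ∫ _y : I → unitInterval, (1 - 1 / Real.exp 1) * (O.card * w i) := by simp
  rw [hconst]
  refine integral_mono_ae (integrable_const _) hHint'.integral_prod_left ?_
  have hgen := Measure.ae_ae_of_ae_prod (hmp.quasiMeasurePreserving.ae (ae_seedValue_ne w))
  filter_upwards [hgen, hHint'.prod_right_ae] with y hy hyint
  -- the value of an arrival in the run without `i` does not depend on the seed of `i`
  set q : I → ℕ := Function.update r i 0 with hq
  have hqi : q i = 0 := by simp [hq]
  set l : Fin m → ℝ := fun t =>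
    (greedyMatch (ν.greedyOffer tie y) live (List.finRange m) q t).elim 0 (seedValue w y) with hl
  have hl0 : ∀ t, 0 ≤ l t := fun t => by
    simp only [hl]
    cases greedyMatch (ν.greedyOffer tie y) live (List.finRange m) q t with
    | none => exact le_rfl
    | some j => exact seedValue_nonneg hw y j
  have hlz : ∀ z t, (greedyMatch (ν.greedyOffer tie (Function.update y i z)) live
      (List.finRange m) q t).elim 0 (seedValue w (Function.update y i z)) = l t := fun z t => by
    rw [greedyMatch_congr_of_eq_zero
      (fun S hS t => ν.greedyOffer_update tie y i z S hS t) live _ q hqi]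
    have hne := greedyMatch_ne_some (fun S t j h => (ν.greedyOffer_mem tie y S t j h).1) live
      (List.finRange m) q hqi t
    simp only [hl]
    cases h : greedyMatch (ν.greedyOffer tie y) live (List.finRange m) q t with
    | none => rfl
    | some j => exact seedValue_update_of_ne w y z fun hji => hne (by rw [h, hji])
  let g : Fin m → unitInterval → ℝ := fun t z =>
    if l t < w i * (1 - Real.exp ((z : ℝ) - 1)) then w i * Real.exp ((z : ℝ) - 1) else 0
  have hgint : ∀ t, Integrable (g t) := fun t => integrable_seed_gain (w i) (l t)
  have hlg : ∀ t, Integrable fun z => l t + g t z := fun t => (integrable_const _).add (hgint t)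
  calc (1 - 1 / Real.exp 1) * (O.card * w i)
      = ∑ t ∈ O, (1 - 1 / Real.exp 1) * w i := by
        rw [Finset.sum_const, nsmul_eq_mul]; ring
    _ ≤ ∑ t ∈ O, (l t + ∫ z, g t z) :=
        Finset.sum_le_sum fun t _ => le_integral_seed_gain hwi (hl0 t)
    _ = ∫ z, ∑ t ∈ O, (l t + g t z) := by
        rw [integral_finsetSum _ fun t _ => hlg t]
        refine Finset.sum_congr rfl fun t _ => ?_
        rw [integral_add (integrable_const _) (hgint t)]
        simp
    _ ≤ ∫ z, H (Function.update y i z) := by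
        refine integral_mono_ae (integrable_finsetSum _ fun t _ => hlg t) hyint ?_
        filter_upwards [hy, compl_mem_ae_iff.2 (measure_singleton (1 : unitInterval))]
          with z hz hz1
        -- almost surely, the seed of `i` is not `1`, so that `i` has a positive value
        have hvi : seedValue w (Function.update y i z) i =
            w i * (1 - Real.exp ((z : ℝ) - 1)) := by simp [seedValue]
        have hpos : 0 < seedValue w (Function.update y i z) i := by
          rw [hvi]
          have hz1' : (z : ℝ) < 1 := lt_of_le_of_ne z.2.2 fun h => hz1 (Subtype.ext h)
          have := Real.exp_lt_one_iff.2 (show (z : ℝ) - 1 < 0 by linarith)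
          exact mul_pos hwi (by linarith)
        obtain ⟨h1, h2⟩ := ν.greedyMatch_compare (seedValue_nonneg hw _) hz (hoff _) hpos
          (List.finRange m) (List.nodup_finRange m) r q hqi
          (fun j _ => by
            by_cases hj : j = i
            · simp [hj, hqi]
            · simp [hq, hj])
          (fun j hj => by
            have : j ≠ i := fun h => by rw [h] at hj; exact lt_irrefl _ hj
            simp [hq, this])
        simp only [hlz] at h1 h2
        rw [hvi] at h2
        set N := Finset.univ.filter fun t => G (Function.update y i z) t = some i with hN
        have hK : (O.filter fun t => l t < w i * (1 - Real.exp ((z : ℝ) - 1))).card ≤ N.card := by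
          refine le_trans (le_min ((Finset.card_filter_le _ _).trans hcard)
            (Finset.card_le_card fun t ht => ?_)) h2
          obtain ⟨ht, hlt⟩ := Finset.mem_filter.1 ht
          simp [hO t ht, hlt]
        have hNsum : (∑ t, (G (Function.update y i z) t).elim 0 fun j =>
            if j = i then w i * Real.exp (((Function.update y i z i : unitInterval) : ℝ) - 1)
              else 0) = N.card * (w i * Real.exp ((z : ℝ) - 1)) := by
          rw [← nsmul_eq_mul, ← Finset.sum_const, hN, Finset.sum_filter]
          refine Finset.sum_congr rfl fun t _ => ?_
          cases G (Function.update y i z) t <;> simp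
        simp only [hH]
        rw [hNsum, Finset.sum_add_distrib, add_comm]
        refine add_le_add ?_ (Finset.sum_le_sum fun t _ => h1 t)
        simp only [g]
        rw [← Finset.sum_filter, Finset.sum_const, nsmul_eq_mul]
        exact mul_le_mul_of_nonneg_right (by exact_mod_cast hK)
          (mul_nonneg hwi.le (Real.exp_pos _).le)

/-- On presampled capacities, Perturbed Greedy is `(1 - 1 / e)`-competitive with every matching. -/
theorem le_integral_sum_greedyMatch (ν : StochasticMatching I m) (tie : TieBreaking I m)
    {w : I → ℝ} (hw : ∀ i, 0 ≤ w i) {live : Fin m → Bool}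
    (hoff : ∀ y, ν.IsGreedy (seedValue w y) live (ν.greedyOffer tie y)) (r : I → ℕ)
    (M : Fin m → Option I) (hM : ∀ t i, M t = some i → live t ∧ (i, t) ∈ ν.edges)
    (hcard : ∀ i, (Finset.univ.filter fun t => M t = some i).card ≤ r i) :
    (1 - 1 / Real.exp 1) * ∑ t, (M t).elim 0 w ≤ ∫ y,
      ∑ t, (greedyMatch (ν.greedyOffer tie y) live (List.finRange m) r t).elim 0 w := by
  have hsum : ∑ t, (M t).elim 0 w =
      ∑ i, (Finset.univ.filter fun t => M t = some i).card * w i := by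
    simp only [elim_eq_sum]
    rw [Finset.sum_comm]
    refine Finset.sum_congr rfl fun i _ => ?_
    rw [← Finset.sum_filter, Finset.sum_const, nsmul_eq_mul]
  have hint1 : ∀ t i, Integrable fun y : I → unitInterval =>
      (greedyMatch (ν.greedyOffer tie y) live (List.finRange m) r t).elim 0
        fun j => if j = i then w i * Real.exp ((y i : ℝ) - 1) else 0 := fun t i =>
    ν.integrable_greedyMatch tie live _ r t
      (fun y j => if j = i then w i * Real.exp ((y i : ℝ) - 1) else 0) fun j => by
        by_cases hj : j = i
        · simp only [hj, if_true]; fun_prop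
        · simp only [hj, if_false]; fun_prop
  have hint2 : ∀ t, Integrable fun y : I → unitInterval =>
      (greedyMatch (ν.greedyOffer tie y) live (List.finRange m) r t).elim 0 (seedValue w y) :=
    fun t => ν.integrable_greedyMatch tie live _ r t _ fun j => by unfold seedValue; fun_prop
  have hint3 : ∀ i, Integrable fun y : I → unitInterval =>
      ((∑ t, (greedyMatch (ν.greedyOffer tie y) live (List.finRange m) r t).elim 0
          fun j => if j = i then w i * Real.exp ((y i : ℝ) - 1) else 0) +
        ∑ t ∈ Finset.univ.filter fun t => M t = some i,
          (greedyMatch (ν.greedyOffer tie y) live (List.finRange m) r t).elim 0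
            (seedValue w y)) := fun i =>
    (integrable_finsetSum _ fun t _ => hint1 t i).add
      (integrable_finsetSum _ fun t _ => hint2 t)
  rw [hsum, Finset.mul_sum]
  refine (Finset.sum_le_sum fun i _ => ν.le_integral_greedyMatch tie hw hoff r i
    (Finset.univ.filter fun t => M t = some i)
    (fun t ht => hM t i (Finset.mem_filter.1 ht).2) (hcard i)).trans ?_
  rw [← integral_finsetSum _ fun i _ => hint3 i]
  refine integral_mono (integrable_finsetSum _ fun i _ => hint3 i)
    (integrable_finsetSum _ fun t _ => ν.integrable_greedyMatch tie live _ r t (fun _ => w)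
      fun _ => continuous_const) fun y => ?_
  dsimp only
  -- every attempt splits its weight between the resource and the arrival
  generalize greedyMatch (ν.greedyOffer tie y) live (List.finRange m) r = G
  have hval : ∀ t, 0 ≤ (G t).elim 0 (seedValue w y) := fun t => by
    cases G t with
    | none => exact le_rfl
    | some j => exact seedValue_nonneg hw y j
  have h1 : (∑ i, ∑ t, (G t).elim 0 fun j =>
      if j = i then w i * Real.exp ((y i : ℝ) - 1) else 0) =
      ∑ t, (G t).elim 0 fun i => w i * Real.exp ((y i : ℝ) - 1) := by
    rw [Finset.sum_comm]
    refine Finset.sum_congr rfl fun t _ => ?_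
    cases G t <;> simp
  have h2 : (∑ i, ∑ t ∈ Finset.univ.filter fun t => M t = some i,
      (G t).elim 0 (seedValue w y)) ≤ ∑ t, (G t).elim 0 (seedValue w y) := by
    simp only [Finset.sum_filter]
    rw [Finset.sum_comm]
    refine Finset.sum_le_sum fun t _ => ?_
    rw [← elim_eq_sum (M t) fun _ => (G t).elim 0 (seedValue w y)]
    cases M t with
    | none => exact hval t
    | some j => exact le_rfl
  rw [Finset.sum_add_distrib, h1]
  refine (add_le_add le_rfl h2).trans (le_of_eq ?_)
  rw [← Finset.sum_add_distrib]
  refine Finset.sum_congr rfl fun t _ => ?_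
  cases G t with
  | none => simp
  | some j => simp only [Option.elim_some, seedValue]; ring

/-! ### Comparison with offline plans -/

/-- The reward of a plan that starts from scratch, in terms of presampled capacities. -/
theorem planValue_eq_bernoulliExp (ν : StochasticMatching I m) {a : I → ℝ} {b : Fin m → ℝ}
    (hab : ∀ i t, (i, t) ∈ ν.edges → ν.prob i t = a i * b t) (π : OfflinePlan I m)
    (h : ν.Feasible π Finset.univ Finset.univ) :
    ν.planValue π = bernoulliExp (Sum.elim b fun e : I × Fin m => a e.1)
      (fun s => planAttempts (fun i => a i * ν.weight i) (fun t => s (.inl t)) π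
        (capacities s Finset.univ fun _ => m)) := by
  rw [ν.planValue_eq_planMean π _ _ h,
    ν.bernoulliExp_planAttempts hab π _ _ _ h fun i => by simp]

theorem le_perturbedGreedy_of_feasible (ν : StochasticMatching I m) (hν : ν.Decomposable)
    (tie : TieBreaking I m) (π : OfflinePlan I m) (h : ν.Feasible π Finset.univ Finset.univ) :
    (1 - 1 / Real.exp 1) * ν.planValue π ≤ ν.perturbedGreedy tie := by
  obtain ⟨a, b, ha, hb, hab⟩ := hν
  set w : I → ℝ := fun i => a i * ν.weight i with hwdef
  have hw : ∀ i, 0 ≤ w i := fun i => mul_nonneg (ha i).1 (ν.weight_nonneg i)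
  let p : Fin m ⊕ I × Fin m → ℝ := Sum.elim b fun e => a e.1
  let P : (Fin m ⊕ I × Fin m → Bool) → ℝ := fun s => ∏ e, if s e then p e else 1 - p e
  let r : (Fin m ⊕ I × Fin m → Bool) → I → ℕ := fun s => capacities s Finset.univ fun _ => m
  have hr : ∀ s i, 0 < r s i := fun s i => by
    simpa [r, capacities] using capacity_pos s i m
  have hP : ∀ s, 0 ≤ P s := fun s => Finset.prod_nonneg fun e _ => by
    have hp : 0 ≤ p e ∧ p e ≤ 1 := by
      rcases e with t | e
      · exact hb t
      · exact ha e.1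
    split_ifs
    · exact hp.1
    · linarith [hp.2]
  have hgreedy : ∀ y, (∑ s, ν.pathProb s *
      ν.greedyReward tie y s (List.finRange m) Finset.univ) = ∑ s, P s *
        ∑ t, (greedyMatch (ν.greedyOffer tie y) (fun t => s (.inl t)) (List.finRange m)
          (r s) t).elim 0 w := fun y => by
    have hfeas := ν.feasible_greedyPlan (ν.greedyOffer_mem tie y) (List.finRange m)
      (List.nodup_finRange m) Finset.univ Finset.univ fun _ _ => Finset.mem_univ _
    have h1 := ν.planValue_eq_bernoulliExp hab _ hfeas
    unfold planValue bernoulliExp at h1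
    simp only [planReward_greedyPlan] at h1
    rw [h1]
    refine Finset.sum_congr rfl fun s _ => ?_
    have huniv : (Finset.univ.filter fun i => 0 < r s i) = Finset.univ := by
      ext i; simp [hr]
    have h2 := ν.planAttempts_greedyPlan (ν.greedyOffer_mem tie y) w (fun t => s (.inl t))
      (List.finRange m) (List.nodup_finRange m) (r s)
    rw [huniv] at h2
    rw [← h2]
  have hint : ∀ s, Integrable fun y : I → unitInterval => P s *
      ∑ t, (greedyMatch (ν.greedyOffer tie y) (fun t => s (.inl t)) (List.finRange m)
        (r s) t).elim 0 w := fun s =>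
    (integrable_finsetSum _ fun t _ => ν.integrable_greedyMatch tie _ _ _ t (fun _ => w)
      fun _ => continuous_const).const_mul _
  unfold perturbedGreedy
  simp only [hgreedy]
  rw [integral_finsetSum _ fun s _ => hint s, ν.planValue_eq_bernoulliExp hab π h,
    bernoulliExp, Finset.mul_sum]
  refine Finset.sum_le_sum fun s _ => ?_
  rw [integral_const_mul, mul_left_comm]
  change P s * _ ≤ P s * _
  rcases (hP s).eq_or_lt with h0 | h0
  · rw [← h0, zero_mul, zero_mul]
  refine mul_le_mul_of_nonneg_left ?_ h0.le
  -- on paths of positive probability, live arrivals have a positive probability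
  have hlive : ∀ t, s (.inl t) → 0 < b t := fun t ht => by
    refine lt_of_le_of_ne (hb t).1 fun hbt => h0.ne' ?_
    exact Finset.prod_eq_zero (Finset.mem_univ (.inl t)) (by simp [ht, p, ← hbt])
  obtain ⟨M, hM, hcard, hsum⟩ := ν.exists_matching_planAttempts w (fun t => s (.inl t)) π
    Finset.univ Finset.univ (r s) h fun i => by simp [hr]
  rw [hsum]
  exact ν.le_integral_sum_greedyMatch tie hw
    (fun y => ν.isGreedy_greedyOffer tie hab hlive y) (r s) M (fun t i h => (hM t i h).2) hcard

end StochasticMatching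

theorem theorem2 {I : Type*} [Fintype I] [DecidableEq I] {m : ℕ}
    (ν : StochasticMatching I m) (hν : ν.Decomposable) (tie : TieBreaking I m) :
    (1 - 1 / Real.exp 1) * ν.opt ≤ ν.perturbedGreedy tie := by
  have he : 0 < 1 - 1 / Real.exp 1 := by
    have h1 : (1 : ℝ) < Real.exp 1 := Real.one_lt_exp_iff.2 one_pos
    have := (div_lt_one (Real.exp_pos 1)).2 h1
    linarith
  rw [mul_comm, ← le_div_iff₀ he]
  have := ν.nonempty_offlineAlgorithm
  -- a randomized algorithm is a mixture of plans
  refine ciSup_le fun q => ?_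
  have hone := (ν.hasSum_toReal q).mul_right (ν.perturbedGreedy tie / (1 - 1 / Real.exp 1))
  rw [one_mul] at hone
  refine hasSum_le (fun π => mul_le_mul_of_nonneg_left ?_ ENNReal.toReal_nonneg)
    (ν.summable_offlineValue q).hasSum hone
  rw [le_div_iff₀ he, mul_comm]
  exact ν.le_perturbedGreedy_of_feasible hν tie π.1 π.2
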